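/- Conventions. All graphs and simplicial complexes are finite; the simplices of a complex are non-empty sets. For a vertex $x$ of a graph, the unit sphere $S(x)$ is the subgraph induced on the neighbours of $x$. A graph is contractible if it has exactly one vertex, or if it has a vertex $x$ such that both $S(x)$ and the graph with $x$ removed are contractible. The empty graph is the $(-1)$-sphere. A graph is a $d$-manifold if all its unit spheres $S(x)$ are $(d-1)$-spheres, and for $d\ge 0$ a $d$-sphere is a $d$-manifold that becomes contractible after the removal of some vertex. For a simplex $x$ of a simplicial complex $G$, the unit sphere $S(x)$ is the graph whose vertices are the simplices of $G$ strictly contained in $x$ or strictly containing $x$, two of them being adjacent if one is strictly contained in the other; $G$ is a $d$-manifold if $S(x)$ is a $(d-1)$-sphere for every simplex $x\in G$. Corollary. Let $d,k\ge 0$, let $G$ be a simplicial complex with vertex set $V$ that is a $d$-manifold, and let $f: V\to\{0,1,\dots,k\}$ be surjective. Let $P=K_{k+1}=K_{(1,\dots,1)}$ be the complex of all non-empty subsets of $\{0,\dots,k\}$. Let $U$ be the set of simplices $y\in G$ such that $f(y)$ contains a facet of $P$, that is, $f(y)=\{0,\dots,k\}$. Regard $U$ as a graph in which two simplices are adjacent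 if one is strictly contained in the other, and let $H=H(G,f,P)$ be the simplicial complex of its non-empty complete subgraphs. Then $H$ is a $(d-k)$-manifold or empty; more precisely, if $H$ is non-empty, then both the graph $U$ and the complex $H$ are $(d-k)$-manifolds. -/

import Mathlib

namespace DiscreteManifold

/-! ### Contractible graphs, spheres and manifolds

All finite graphs are handled as induced subgraphs of an ambient simple graph `Γ` on `W`: a set
`A : Set W` stands for the subgraph of `Γ` induced on `A`. -/

section Graphs

variable {W : Type*}

/-- The unit sphere `S(x)` in the graph induced on `A`: the subgraph induced on the neighbours of
`x`. -/
def unitSphere (Γ : SimpleGraph W) (A : Set W) (x : W) : Set W :=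
  {y | y ∈ A ∧ Γ.Adj x y}

/-- Contractible graphs: the one-point graph is contractible, and a graph is contractible if it has
a vertex `x` such that both `S(x)` and the graph without `x` are contractible.
(The empty graph is not contractible; contractible graphs are finite.) -/
inductive IsContractible (Γ : SimpleGraph W) : Set W → Prop
  | point (x : W) : IsContractible Γ {x}
  | extend (A : Set W) (x : W) (hx : x ∈ A)
      (hS : IsContractible Γ (unitSphere Γ A x))
      (hA : IsContractible Γ (A \ {x})) : IsContractible Γ A

/-- Spheres: the empty graph is the `(-1)`-sphere, and for `d ≥ 0` a `d`-sphere is a graph all of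
whose unit spheres are `(d-1)`-spheres (a `d`-manifold) and which becomes contractible after the
removal of some vertex. -/
inductive IsSphere (Γ : SimpleGraph W) : ℤ → Set W → Prop
  | empty : IsSphere Γ (-1) ∅
  | step (d : ℤ) (hd : 0 ≤ d) (A : Set W)
      (hS : ∀ x ∈ A, IsSphere Γ (d - 1) (unitSphere Γ A x))
      (hA : ∃ x ∈ A, IsContractible Γ (A \ {x})) : IsSphere Γ d A

/-- A `d`-manifold is a finite graph all of whose unit spheres are `(d-1)`-spheres. -/
def IsManifoldGraph (Γ : SimpleGraph W) (d : ℤ) (A : Set W) : Prop :=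
  A.Finite ∧ ∀ x ∈ A, IsSphere Γ (d - 1) (unitSphere Γ A x)

/-- The simplicial complex of the (non-empty, finite) complete subgraphs of the graph induced
on `A`. -/
def cliqueComplex (Γ : SimpleGraph W) (A : Set W) : PreAbstractSimplicialComplex W where
  faces := {s | s.Nonempty ∧ (s : Set W) ⊆ A ∧ Γ.IsClique (s : Set W)}
  isRelLowerSet_faces := by
    rintro s ⟨hne, hA, hc⟩
    refine ⟨hne, fun t hts ht => ⟨ht, ?_, ?_⟩⟩
    · exact (Finset.coe_subset.mpr hts).trans hA
    · exact hc.subset (Finset.coe_subset.mpr hts)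

end Graphs

/-! ### Complexes -/

section Complexes

variable {V β : Type*}

/-- The graph on finite sets in which two different sets are adjacent if one contains the other. -/
def inclusionGraph (V : Type*) : SimpleGraph (Finset V) where
  Adj a b := a ⊂ b ∨ b ⊂ a
  symm := ⟨fun _ _ h => h.symm⟩
  loopless := ⟨fun a h => h.elim (ssubset_irrefl a) (ssubset_irrefl a)⟩

/-- A finite simplicial complex is a `d`-manifold if for every simplex `x` the unit sphere `S(x)`
is a `(d-1)`-sphere. Here `S(x)` is the join of `S⁻(x)`, the simplices strictly contained in `x`,
and `S⁺(x)`, the simplices strictly containing `x`; that is, the unit sphere of `x` in the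
inclusion graph on the set of simplices. -/
def IsManifold (d : ℤ) (K : PreAbstractSimplicialComplex V) : Prop :=
  IsManifoldGraph (inclusionGraph V) d K.faces

/-- The set `U` of simplices `y` of `G` whose image `f(y)` contains a facet (maximal simplex)
of `P`. -/
def pullbackSet [DecidableEq β] (G : AbstractSimplicialComplex V) (f : V → β)
    (P : PreAbstractSimplicialComplex β) : Set (Finset V) :=
  {y | y ∈ G.faces ∧ ∃ t, Maximal (fun s => s ∈ P.faces) t ∧ t ⊆ y.image f}

/-- `H(G, f, P)`: the complex of complete subgraphs of the inclusion graph on `U`. -/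
def pullback [DecidableEq β] (G : AbstractSimplicialComplex V) (f : V → β)
    (P : PreAbstractSimplicialComplex β) : PreAbstractSimplicialComplex (Finset V) :=
  cliqueComplex (inclusionGraph V) (pullbackSet G f P)

/-- The complete complex `K_{k+1} = K_{(1,…,1)}` on the vertex set `{0,…,k}`: every non-empty
subset is a simplex. -/
def completeComplex (k : ℕ) : PreAbstractSimplicialComplex (Fin (k + 1)) := ⊤

end Complexes

end DiscreteManifold

/-! For `y` in `U`, every simplex above `y` is again in `U`, so the unit sphere of `y` in `U` is the
join of two pieces.

Below `y` are the proper subsets of `y` that meet every fibre. Choosing one is choosing a non-empty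
part of each fibre of `f` on `y`, so these sets are the proper faces of a product of `k + 1`
simplices of total dimension `|y| - k - 1`; its boundary is a `(|y| - k - 2)`-sphere
(`isSphere_hitting`). Above `y`, the manifold condition gives a `(d - |y|)`-sphere
(`IsManifold.isSphere_above`). By `IsSphere.join` the join is a `(d - k - 1)`-sphere.

The complex `H` is the barycentric refinement of `U`, and refinement preserves manifolds
(`IsSphere.cliquesAbove`, `IsManifoldGraph.cliqueComplex`). The contractibility claims rest on cones
and on `IsContractible.of_dismantle`, mostly through closure and interior operators. -/

namespace DiscreteManifold

/-! ### Contractibility, joins and links in a graph -/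

section Graphs

variable {W : Type*} {Γ : SimpleGraph W}

lemma IsContractible.finite {A : Set W} (h : IsContractible Γ A) : A.Finite := by
  induction h with
  | point x => exact Set.finite_singleton x
  | extend A x hx _ _ _ ih => exact (ih.insert x).subset (by simp)

lemma IsSphere.finite {d : ℤ} {A : Set W} (h : IsSphere Γ d A) : A.Finite := by
  cases h with
  | empty => exact Set.finite_empty
  | step d hd A hS hA =>
    obtain ⟨x, -, hx⟩ := hA
    exact (hx.finite.insert x).subset (by simp)

lemma IsSphere.unitSphere {d : ℤ} {A : Set W} (h : IsSphere Γ d A) {x : W} (hx : x ∈ A) :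
    IsSphere Γ (d - 1) (unitSphere Γ A x) := by
  cases h with
  | empty => exact absurd hx (Set.notMem_empty x)
  | step d hd A hS hA => exact hS x hx

lemma IsSphere.neg_one_le {d : ℤ} {A : Set W} (h : IsSphere Γ d A) : -1 ≤ d := by
  cases h with
  | empty => exact le_rfl
  | step d hd A hS hA => omega

lemma unitSphere_subset (A : Set W) (x : W) : unitSphere Γ A x ⊆ A := fun _ h => h.1

/-- Cones are contractible. -/
lemma isContractible_of_apex {A : Set W} (hA : A.Finite) {p : W} (hp : p ∈ A)
    (h : ∀ y ∈ A, y ≠ p → Γ.Adj p y) : IsContractible Γ A := by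
  induction hn : A.ncard using Nat.strong_induction_on generalizing A with
  | _ n ih =>
    by_cases hex : ∃ y ∈ A, y ≠ p
    · obtain ⟨y, hy, hyp⟩ := hex
      have hlt : ∀ B : Set W, B ⊆ A \ {y} → B.ncard < n := fun B hB => by
        rw [← hn]
        exact Set.ncard_lt_ncard ⟨hB.trans Set.sdiff_subset, fun h' => (hB (h' hy)).2 rfl⟩ hA
      -- The unit sphere of `y` and the graph without `y` are smaller cones with the same apex `p`.
      refine .extend A y hy ?_ ?_
      · have hsub : unitSphere Γ A y ⊆ A \ {y} := fun z hz => ⟨hz.1, fun e => by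
          have := hz.2
          rw [Set.mem_singleton_iff.1 e] at this
          exact Γ.irrefl this⟩
        exact ih _ (hlt _ hsub) (hA.subset (unitSphere_subset _ _)) ⟨hp, (h y hy hyp).symm⟩
          (fun z hz => h z hz.1) rfl
      · exact ih _ (hlt _ subset_rfl) (hA.subset Set.sdiff_subset) ⟨hp, hyp.symm⟩
          (fun z hz => h z hz.1) rfl
    · push Not at hex
      have : A = {p} := Set.eq_singleton_iff_unique_mem.2 ⟨hp, hex⟩
      rw [this]
      exact .point p

/-- If the vertices of `A` outside `A'` can be removed in the order of increasing `r`, with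
contractible unit spheres at the time of removal, then contractibility of `A'` implies that
of `A`. -/
lemma IsContractible.of_dismantle {A A' : Set W} (hA : A.Finite) (hA' : A' ⊆ A) (r : W → ℤ)
    (hr : ∀ x ∈ A, ∀ y ∈ A, Γ.Adj x y → r x ≠ r y)
    (h : ∀ x ∈ A, x ∉ A' → IsContractible Γ {y | y ∈ A ∧ Γ.Adj x y ∧ (y ∈ A' ∨ r x < r y)})
    (hc : IsContractible Γ A') : IsContractible Γ A := by
  induction hn : (A \ A').ncard using Nat.strong_induction_on generalizing A with
  | _ n ih =>
    rcases (A \ A').eq_empty_or_nonempty with he | hne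
    · rwa [(Set.sdiff_eq_empty.1 he).antisymm hA']
    obtain ⟨x, hx, hmin⟩ := Set.exists_min_image _ r (hA.subset Set.sdiff_subset) hne
    refine .extend A x hx.1 ?_ ?_
    · convert h x hx.1 hx.2 using 1
      ext y
      refine ⟨fun hy => ⟨hy.1, hy.2, ?_⟩, fun hy => ⟨hy.1, hy.2.1⟩⟩
      by_cases hyA : y ∈ A'
      · exact .inl hyA
      · exact .inr (lt_of_le_of_ne (hmin y ⟨hy.1, hyA⟩) (hr x hx.1 y hy.1 hy.2))
    · refine ih _ ?_ (hA.subset Set.sdiff_subset)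
        (fun y hy => ⟨hA' hy, fun e => hx.2 (Set.mem_singleton_iff.1 e ▸ hy)⟩)
        (fun y hy z hz => hr y hy.1 z hz.1) ?_ rfl
      · rw [← hn]
        exact Set.ncard_lt_ncard ⟨fun z hz => ⟨hz.1.1, hz.2⟩, fun h' => (h' hx).1.2 rfl⟩
          (hA.subset Set.sdiff_subset)
      · intro y hy hyA
        -- Removing `x` leaves this set unchanged: `x` is outside `A'` and has minimal `r`, so it
        -- never occurs among the later neighbours of `y`.
        convert h y hy.1 hyA using 1
        ext z
        refine ⟨fun hz => ⟨hz.1.1, hz.2⟩, fun hz => ⟨⟨hz.1, ?_⟩, hz.2⟩⟩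
        rintro rfl
        rcases hz.2.2 with hz' | hz'
        · exact hx.2 hz'
        · exact absurd (hmin y ⟨hy.1, hyA⟩) (not_le.2 hz')

lemma unitSphere_union_left {A B : Set W} (h : ∀ x ∈ A, ∀ y ∈ B, Γ.Adj x y) {x : W} (hx : x ∈ A) :
    unitSphere Γ (A ∪ B) x = unitSphere Γ A x ∪ B := by
  ext y
  constructor
  · rintro ⟨hy | hy, hxy⟩
    · exact .inl ⟨hy, hxy⟩
    · exact .inr hy
  · rintro (hy | hy)
    · exact ⟨.inl hy.1, hy.2⟩
    · exact ⟨.inr hy, h x hx y hy⟩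

lemma union_diff_singleton_left {A B : Set W} (h : ∀ x ∈ A, ∀ y ∈ B, Γ.Adj x y) {x : W}
    (hx : x ∈ A) : (A ∪ B) \ {x} = A \ {x} ∪ B := by
  ext y
  have : y ∈ B → y ≠ x := fun hy e => by subst e; exact Γ.irrefl (h _ hx _ hy)
  simp only [Set.mem_sdiff, Set.mem_union, Set.mem_singleton_iff]
  tauto

/-- The join of a contractible graph with any finite graph is contractible. -/
lemma IsContractible.join {A B : Set W} (hA : IsContractible Γ A) (hB : B.Finite)
    (h : ∀ x ∈ A, ∀ y ∈ B, Γ.Adj x y) : IsContractible Γ (A ∪ B) := by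
  induction hA with
  | point x =>
    refine isContractible_of_apex ((Set.finite_singleton x).union hB) (.inl rfl) ?_
    rintro y (hy | hy) hyx
    · exact absurd hy hyx
    · exact h x rfl y hy
  | extend A x hx _ _ ihS ihA =>
    refine .extend _ x (.inl hx) ?_ ?_
    · rw [unitSphere_union_left h hx]
      exact ihS fun z hz => h z hz.1
    · rw [union_diff_singleton_left h hx]
      exact ihA fun z hz => h z hz.1

/-- The join of an `a`-sphere and a `b`-sphere is an `(a + b + 1)`-sphere. -/
lemma IsSphere.join {a b : ℤ} {A B : Set W} (hA : IsSphere Γ a A) (hB : IsSphere Γ b B)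
    (h : ∀ x ∈ A, ∀ y ∈ B, Γ.Adj x y) : IsSphere Γ (a + b + 1) (A ∪ B) := by
  induction hA generalizing b B with
  | empty => simpa using hB
  | step a ha A hS hAc ihA =>
    induction hB with
    | empty => simpa using IsSphere.step a ha A hS hAc
    | step b hb B hSB hBc ihB =>
      refine .step _ (by omega) _ ?_ ?_
      · rintro x (hx | hx)
        · rw [unitSphere_union_left h hx]
          convert ihA x hx (IsSphere.step b hb B hSB hBc) (fun z hz => h z hz.1) using 1
          ring
        · have h' : ∀ x ∈ B, ∀ y ∈ A, Γ.Adj x y := fun x hx y hy => (h y hy x hx).symm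
          rw [Set.union_comm, unitSphere_union_left h' hx, Set.union_comm]
          convert ihB x hx (fun z hz y hy => h z hz y hy.1) using 1
          ring
      · obtain ⟨x, hx, hc⟩ := hAc
        refine ⟨x, .inl hx, ?_⟩
        rw [union_diff_singleton_left h hx]
        exact hc.join (IsSphere.step b hb B hSB hBc).finite fun z hz => h z hz.1

/-- The common neighbours in `A` of the vertices in `s`. -/
def commonLink (Γ : SimpleGraph W) (A s : Set W) : Set W :=
  {y | y ∈ A ∧ ∀ x ∈ s, Γ.Adj x y}

lemma commonLink_insert (A s : Set W) (x : W) :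
    commonLink Γ A (insert x s) = commonLink Γ (unitSphere Γ A x) s := by
  ext y
  simp only [commonLink, unitSphere, Set.mem_ofPred_eq, Set.forall_mem_insert]
  tauto

/-- The link of a clique with `n` vertices in an `m`-sphere is an `(m - n)`-sphere. -/
lemma IsSphere.commonLink {m : ℤ} {A : Set W} (hA : IsSphere Γ m A) (s : Finset W)
    (hs : (s : Set W) ⊆ A) (hc : Γ.IsClique (s : Set W)) :
    IsSphere Γ (m - s.card) (commonLink Γ A (s : Set W)) := by
  classical
  induction s using Finset.induction_on generalizing m A with
  | empty => simpa [DiscreteManifold.commonLink] using hA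
  | insert x s hx ih =>
    rw [Finset.coe_insert] at hs hc ⊢
    rw [commonLink_insert, Finset.card_insert_of_notMem hx]
    rw [SimpleGraph.isClique_insert_of_notMem (by simpa using hx)] at hc
    convert ih (hA.unitSphere (hs (Set.mem_insert _ _)))
      (fun y hy => ⟨hs (Set.mem_insert_of_mem _ hy), hc.2 y hy⟩) hc.1 using 1
    push_cast
    ring

/-- A manifold need not be a sphere, but the unit sphere at one vertex of the clique is, and the
remaining vertices form a clique inside it. This is why `s` must be non-empty. -/
lemma IsManifoldGraph.commonLink {m : ℤ} {A : Set W} (hA : IsManifoldGraph Γ m A) (s : Finset W)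
    (hne : s.Nonempty) (hs : (s : Set W) ⊆ A) (hc : Γ.IsClique (s : Set W)) :
    IsSphere Γ (m - s.card) (commonLink Γ A (s : Set W)) := by
  classical
  obtain ⟨x, hx⟩ := hne
  obtain ⟨s, hxs, rfl⟩ : ∃ t, x ∉ t ∧ insert x t = s :=
    ⟨s.erase x, Finset.notMem_erase x s, Finset.insert_erase hx⟩
  rw [Finset.coe_insert] at hs hc ⊢
  rw [commonLink_insert, Finset.card_insert_of_notMem hxs]
  rw [SimpleGraph.isClique_insert_of_notMem (by simpa using hxs)] at hc
  convert (hA.2 x (hs (Set.mem_insert _ _))).commonLink s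
    (fun y hy => ⟨hs (Set.mem_insert_of_mem _ hy), hc.2 y hy⟩) hc.1 using 1
  push_cast
  ring

end Graphs

/-! ### Spheres in posets of finite sets -/

section Inclusion

variable {V : Type*}

lemma inclusionGraph_adj {a b : Finset V} : (inclusionGraph V).Adj a b ↔ a ⊂ b ∨ b ⊂ a := Iff.rfl

lemma unitSphere_inclusionGraph (A : Set (Finset V)) (x : Finset V) :
    unitSphere (inclusionGraph V) A x = {z | z ∈ A ∧ z ⊂ x} ∪ {z | z ∈ A ∧ x ⊂ z} := by
  ext z
  simp only [unitSphere, inclusionGraph_adj, Set.mem_ofPred_eq, Set.mem_union]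
  tauto

lemma card_ne_of_adj {a b : Finset V} (h : (inclusionGraph V).Adj a b) : a.card ≠ b.card :=
  h.elim (fun h => (Finset.card_lt_card h).ne) (fun h => (Finset.card_lt_card h).ne')

/-- A family of sets is contractible if the fixed points of a closure operator on it are. -/
lemma IsContractible.of_closure {A : Set (Finset V)} (hA : A.Finite) (g : Finset V → Finset V)
    (hg : ∀ x ∈ A, g x ∈ A) (hle : ∀ x, x ⊆ g x) (hmono : Monotone g)
    (hidem : ∀ x, g (g x) = g x)
    (hc : IsContractible (inclusionGraph V) {x | x ∈ A ∧ g x = x}) :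
    IsContractible (inclusionGraph V) A := by
  refine hc.of_dismantle hA (fun x hx => hx.1) (fun x => -(x.card : ℤ))
    (fun x _ y _ h e => card_ne_of_adj h (by simpa using e)) fun x hx hxA => ?_
  have hne : x ⊂ g x := (hle x).ssubset_of_ne fun e => hxA ⟨hx, e.symm⟩
  -- Non-fixed sets are removed by decreasing size. A remaining neighbour above `x` is fixed, hence
  -- contains `g x`; one below `x` lies below `g x`.
  refine isContractible_of_apex (hA.subset fun y hy => hy.1) (p := g x)
    ⟨hg x hx, .inl hne, .inl ⟨hg x hx, hidem x⟩⟩ ?_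
  rintro y ⟨-, hxy | hxy, hy⟩ hyp
  · refine .inl (LE.le.ssubset_of_ne ?_ hyp.symm)
    rcases hy with hy | hy
    · exact (hmono hxy.subset).trans_eq hy.2
    · have := Finset.card_lt_card hxy
      omega
  · exact .inr (hxy.trans hne)

/-- A family of sets is contractible if the fixed points of an interior operator on it are. -/
lemma IsContractible.of_interior {A : Set (Finset V)} (hA : A.Finite) (g : Finset V → Finset V)
    (hg : ∀ x ∈ A, g x ∈ A) (hle : ∀ x, g x ⊆ x) (hmono : Monotone g)
    (hidem : ∀ x, g (g x) = g x)
    (hc : IsContractible (inclusionGraph V) {x | x ∈ A ∧ g x = x}) :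
    IsContractible (inclusionGraph V) A := by
  refine hc.of_dismantle hA (fun x hx => hx.1) (fun x => (x.card : ℤ))
    (fun x _ y _ h e => card_ne_of_adj h (by simpa using e)) fun x hx hxA => ?_
  have hne : g x ⊂ x := (hle x).ssubset_of_ne fun e => hxA ⟨hx, e⟩
  refine isContractible_of_apex (hA.subset fun y hy => hy.1) (p := g x)
    ⟨hg x hx, .inr hne, .inl ⟨hg x hx, hidem x⟩⟩ ?_
  rintro y ⟨-, hxy | hxy, hy⟩ hyp
  · exact .inl (hne.trans hxy)
  · refine .inr (LE.le.ssubset_of_ne ?_ hyp)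
    rcases hy with hy | hy
    · exact hy.2.symm.trans_le (hmono hxy.subset)
    · have := Finset.card_lt_card hxy
      omega

lemma finite_setOf_subset (y : Finset V) : {z : Finset V | z ⊆ y}.Finite := by
  classical
  exact y.powerset.finite_toSet.subset fun z hz => by simpa using hz

/-- The sets strictly between `z` and `y` form a sphere, the boundary of the simplex `y \ z`. -/
lemma isSphere_between {z y : Finset V} (h : z ⊂ y) :
    IsSphere (inclusionGraph V) ((y.card : ℤ) - z.card - 2) {w | z ⊂ w ∧ w ⊂ y} := by
  classical
  induction hn : y.card - z.card using Nat.strong_induction_on generalizing z y with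
  | _ n ih =>
    have hcard := Finset.card_lt_card h
    by_cases h1 : y.card = z.card + 1
    · convert IsSphere.empty (Γ := inclusionGraph V) using 1
      · omega
      · refine Set.eq_empty_of_forall_notMem fun w hw => ?_
        have := Finset.card_lt_card hw.1
        have := Finset.card_lt_card hw.2
        omega
    refine .step _ (by omega) _ ?_ ?_
    · rintro w ⟨hzw, hwy⟩
      have h1 := Finset.card_lt_card hzw
      have h2 := Finset.card_lt_card hwy
      have := (ih _ (by omega) hzw rfl).join (ih _ (by omega) hwy rfl)
        (fun a ha b hb => .inl (ha.2.trans hb.1))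
      rw [unitSphere_inclusionGraph]
      convert this using 1
      · ring
      · ext u
        constructor
        · rintro (hu | hu)
          · exact .inl ⟨hu.1.1, hu.2⟩
          · exact .inr ⟨hu.2, hu.1.2⟩
        · rintro (hu | hu)
          · exact .inl ⟨⟨hu.1, hu.2.trans hwy⟩, hu.2⟩
          · exact .inr ⟨⟨hzw.trans hu.1, hu.2⟩, hu.1⟩
    · obtain ⟨v, hvy, hvz⟩ := Finset.exists_of_ssubset h
      have hzv : (insert v z).card = z.card + 1 := Finset.card_insert_of_notMem hvz
      have hyv : (y.erase v).card = y.card - 1 := Finset.card_erase_of_mem hvy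
      have hzey : z ⊂ y.erase v := (Finset.subset_erase.2 ⟨h.1, hvz⟩).ssubset_of_ne
        fun e => by rw [← e] at hyv; omega
      have hfin : ({w | z ⊂ w ∧ w ⊂ y} \ {y.erase v}).Finite :=
        (finite_setOf_subset y).subset fun w hw => hw.1.2.subset
      refine ⟨y.erase v, ⟨hzey, Finset.erase_ssubset hvy⟩, ?_⟩
      -- With `y.erase v` gone, adding `v` never produces `y`; the sets containing `v` form a cone
      -- with apex `insert v z`.
      refine IsContractible.of_closure hfin (fun w => insert v w) ?_
        (fun w => Finset.subset_insert v w)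
        (fun a b hab => Finset.insert_subset_insert v hab) (by simp) ?_
      · rintro w ⟨⟨hzw, hwy⟩, hwe⟩
        refine ⟨⟨hzw.trans_subset (Finset.subset_insert v w),
          (Finset.insert_subset hvy hwy.1).ssubset_of_ne ?_⟩, ?_⟩
        · intro e
          by_cases hvw : v ∈ w
          · exact hwy.ne (by rwa [Finset.insert_eq_of_mem hvw] at e)
          · exact hwe (by rw [← e, Finset.erase_insert hvw]; rfl)
        · intro e
          exact Finset.notMem_erase v y (e ▸ Finset.mem_insert_self v w)
      · refine isContractible_of_apex (hfin.subset fun w hw => hw.1) (p := insert v z)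
          ⟨⟨⟨Finset.ssubset_insert hvz, (Finset.insert_subset hvy h.1).ssubset_of_ne
            fun e => by rw [e] at hzv; omega⟩, fun e =>
            Finset.notMem_erase v y (e ▸ Finset.mem_insert_self v z)⟩, by simp⟩ ?_
        rintro w ⟨hw, hvw⟩ hne
        refine .inl (LE.le.ssubset_of_ne ?_ hne.symm)
        exact Finset.insert_subset (Finset.insert_eq_self.1 hvw) hw.1.1.1

/-- If `y` meets all fibres of `f`, then the proper subsets of `y` with this property form a
sphere, the boundary of a product of simplices. -/
lemma isSphere_hitting {β : Type*} [Fintype β] (f : V → β) {y : Finset V}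
    (hy : ∀ b, ∃ v ∈ y, f v = b) :
    IsSphere (inclusionGraph V) ((y.card : ℤ) - Fintype.card β - 1)
      {z | z ⊂ y ∧ ∀ b, ∃ v ∈ z, f v = b} := by
  classical
  have hcard : ∀ z : Finset V, (∀ b, ∃ v ∈ z, f v = b) → Fintype.card β ≤ z.card := by
    intro z hz
    have : z.image f = Finset.univ := Finset.eq_univ_iff_forall.2 fun b => by
      simpa using hz b
    rw [← Finset.card_univ, ← this]
    exact Finset.card_image_le
  have hmon : ∀ {z w : Finset V}, z ⊆ w → (∀ b, ∃ v ∈ z, f v = b) → ∀ b, ∃ v ∈ w, f v = b :=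
    fun hzw hz b => (hz b).imp fun v hv => ⟨hzw hv.1, hv.2⟩
  induction hn : y.card using Nat.strong_induction_on generalizing y with
  | _ n ih =>
    subst hn
    -- If `f` is injective on `y`, every point of `y` is needed and the sphere is empty. Otherwise
    -- some `v` shares its fibre with `v'` and can be dropped.
    by_cases hinj : Set.InjOn f y
    · have hle : y.card ≤ Fintype.card β := by
        rw [← Finset.card_image_of_injOn hinj]
        exact Finset.card_le_univ _
      convert IsSphere.empty (Γ := inclusionGraph V) using 1
      · have := hcard y hy
        omega
      · refine Set.eq_empty_of_forall_notMem fun w hw => ?_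
        have := Finset.card_lt_card hw.1
        have := hcard w hw.2
        omega
    obtain ⟨v, hv, v', hv', hff, hvv'⟩ : ∃ v ∈ y, ∃ v' ∈ y, f v = f v' ∧ v ≠ v' := by
      simpa [Set.InjOn] using hinj
    have herase : ∀ b, ∃ u ∈ y.erase v, f u = b := fun b => by
      obtain ⟨u, hu, rfl⟩ := hy b
      by_cases huv : u = v
      · exact ⟨v', Finset.mem_erase.2 ⟨hvv'.symm, hv'⟩, by rw [huv, hff]⟩
      · exact ⟨u, Finset.mem_erase.2 ⟨huv, hu⟩, rfl⟩
    have hyv : (y.erase v).card = y.card - 1 := Finset.card_erase_of_mem hv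
    have hypos : 0 < y.card := Finset.card_pos.2 ⟨v, hv⟩
    refine .step _ (by have := hcard _ herase; omega) _ ?_ ?_
    · rintro w ⟨hwy, hw⟩
      have := (ih _ (Finset.card_lt_card hwy) hw rfl).join (isSphere_between hwy)
        (fun a ha b hb => .inl (ha.1.trans hb.1))
      rw [unitSphere_inclusionGraph]
      convert this using 1
      · ring
      · ext u
        constructor
        · rintro (hu | hu)
          · exact .inl ⟨hu.2, hu.1.2⟩
          · exact .inr ⟨hu.2, hu.1.1⟩
        · rintro (hu | hu)
          · exact .inl ⟨⟨hu.1.trans hwy, hu.2⟩, hu.1⟩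
          · exact .inr ⟨⟨hu.2, hmon hu.1.1 hw⟩, hu.1⟩
    · refine ⟨y.erase v, ⟨Finset.erase_ssubset hv, herase⟩, ?_⟩
      have hfin : ({z | z ⊂ y ∧ ∀ b, ∃ v ∈ z, f v = b} \ {y.erase v}).Finite :=
        (finite_setOf_subset y).subset fun w hw => hw.1.1.subset
      refine IsContractible.of_closure hfin (fun w => insert v w) ?_
        (fun w => Finset.subset_insert v w)
        (fun a b hab => Finset.insert_subset_insert v hab) (by simp) ?_
      · rintro w ⟨⟨hwy, hw⟩, hwe⟩
        refine ⟨⟨(Finset.insert_subset hv hwy.1).ssubset_of_ne ?_,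
          hmon (Finset.subset_insert v w) hw⟩, ?_⟩
        · intro e
          by_cases hvw : v ∈ w
          · exact hwy.ne (by rwa [Finset.insert_eq_of_mem hvw] at e)
          · exact hwe (by rw [← e, Finset.erase_insert hvw]; rfl)
        · intro e
          exact Finset.notMem_erase v y (e ▸ Finset.mem_insert_self v w)
      -- The set `c` keeps only `v` from its fibre. Once all sets contain `v`, intersecting with `c`
      -- still meets every fibre, and `c` becomes the apex.
      set c : Finset V := y.filter fun u => u = v ∨ f u ≠ f v with hc
      have hvc : v ∈ c := by simp [hc, hv]
      have hcy : c ⊂ y := (Finset.filter_subset _ _).ssubset_of_ne fun e => by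
        have : v' ∈ c := hc.trans e ▸ hv'
        simp [hc, hvv'.symm, hff] at this
      have hcap : ∀ w : Finset V, w ⊆ y → v ∈ w → (∀ b, ∃ u ∈ w, f u = b) →
          ∀ b, ∃ u ∈ w ∩ c, f u = b := by
        intro w hwy hvw hw b
        by_cases hb : b = f v
        · exact ⟨v, Finset.mem_inter.2 ⟨hvw, hvc⟩, hb.symm⟩
        · obtain ⟨u, hu, rfl⟩ := hw b
          exact ⟨u, Finset.mem_inter.2 ⟨hu, Finset.mem_filter.2 ⟨hwy hu, .inr hb⟩⟩, rfl⟩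
      have hne : ∀ w : Finset V, v ∈ w → w ∉ ({y.erase v} : Set (Finset V)) := fun w hw e =>
        Finset.notMem_erase v y (Set.mem_singleton_iff.1 e ▸ hw)
      refine IsContractible.of_interior (hfin.subset fun w hw => hw.1) (fun w => w ∩ c) ?_
        (fun w => Finset.inter_subset_left)
        (fun a b hab => Finset.inter_subset_inter_right hab) (by simp) ?_
      · rintro w ⟨⟨⟨hwy, hw⟩, -⟩, hvw⟩
        replace hvw : v ∈ w := Finset.insert_eq_self.1 hvw
        have hvwc : v ∈ w ∩ c := Finset.mem_inter.2 ⟨hvw, hvc⟩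
        exact ⟨⟨⟨Finset.inter_subset_left.trans_ssubset hwy, hcap w hwy.1 hvw hw⟩,
          hne _ hvwc⟩, Finset.insert_eq_self.2 hvwc⟩
      · refine isContractible_of_apex (hfin.subset fun w hw => hw.1.1) (p := c)
          ⟨⟨⟨⟨hcy, ?_⟩, hne _ hvc⟩, Finset.insert_eq_self.2 hvc⟩, Finset.inter_self c⟩ ?_
        · exact hmon Finset.inter_subset_right (hcap y subset_rfl hv hy)
        · rintro w ⟨-, hwc⟩ hwne
          exact .inr ((Finset.inter_eq_left.1 hwc).ssubset_of_ne hwne)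

/-- In a manifold of dimension `d`, the simplices strictly containing a simplex `x` form a sphere
of dimension `d - |x|`. -/
lemma IsManifold.isSphere_above {d : ℤ} {K : PreAbstractSimplicialComplex V}
    (hK : IsManifold d K) {x : Finset V} (hx : x ∈ K.faces) :
    IsSphere (inclusionGraph V) (d - x.card) {z | z ∈ K.faces ∧ x ⊂ z} := by
  classical
  have hne : ∀ {s}, s ∈ K.faces → s.Nonempty := fun hs => (K.isRelLowerSet_faces hs).1
  -- Descend a flag of faces of `x`, one vertex at a time: each unit sphere lowers the dimension by
  -- one, until the face is a single vertex with nothing below it.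
  have key : ∀ s ⊆ x, (x \ s).Nonempty → IsSphere (inclusionGraph V) (d - 1 - s.card)
      ({z | z ∈ K.faces ∧ z ⊂ x \ s} ∪ {z | z ∈ K.faces ∧ x ⊂ z}) := by
    intro s
    induction s using Finset.induction_on with
    | empty =>
      intro _ _
      have := hK.2 x hx
      rw [unitSphere_inclusionGraph] at this
      simpa using this
    | insert v s hv ih =>
      intro hs hnon
      have hvx : v ∈ x := hs (Finset.mem_insert_self v s)
      have hlt : x \ insert v s ⊂ x \ s := by
        rw [Finset.sdiff_insert]
        exact Finset.erase_ssubset (Finset.mem_sdiff.2 ⟨hvx, hv⟩)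
      have hcard : (x \ s).card = (x \ insert v s).card + 1 := by
        rw [Finset.sdiff_insert, Finset.card_erase_add_one (Finset.mem_sdiff.2 ⟨hvx, hv⟩)]
      have hltx : x \ insert v s ⊂ x := hlt.trans_subset Finset.sdiff_subset
      have hmem : x \ insert v s ∈ K.faces := (K.isRelLowerSet_faces hx).2 hltx.subset hnon
      have := (ih ((Finset.subset_insert v s).trans hs) (hnon.mono hlt.1)).unitSphere
        (x := x \ insert v s) (.inl ⟨hmem, hlt⟩)
      rw [unitSphere_inclusionGraph] at this
      rw [Finset.card_insert_of_notMem hv]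
      convert this using 1
      · push_cast
        ring
      · ext u
        constructor
        · rintro (hu | hu)
          · exact .inl ⟨.inl ⟨hu.1, hu.2.trans hlt⟩, hu.2⟩
          · exact .inr ⟨.inr hu, hltx.trans hu.2⟩
        · rintro (⟨hu | hu, hu'⟩ | ⟨hu | hu, hu'⟩)
          · exact .inl ⟨hu.1, hu'⟩
          · exact .inr hu
          · have := Finset.card_lt_card hu.2
            have := Finset.card_lt_card hu'
            omega
          · exact .inr hu
  obtain ⟨v, hv⟩ := hne hx
  have hsd : x \ x.erase v = {v} := by
    rw [Finset.sdiff_erase_self hv]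
  have := key (x.erase v) (Finset.erase_subset v x) (by simp [hsd])
  rw [hsd] at this
  convert this using 1
  · have := Finset.card_erase_add_one hv
    omega
  · refine (Set.union_eq_right.2 fun z hz => ?_).symm
    have h1 := Finset.card_lt_card hz.2
    have h2 := (hne hz.1).card_pos
    rw [Finset.card_singleton] at h1
    omega

end Inclusion

/-! ### Barycentric refinement -/

section Barycentric

variable {W : Type*} {Γ : SimpleGraph W}

/-- The cliques strictly containing `c` whose further vertices lie in `A`. -/
def cliquesAbove (Γ : SimpleGraph W) (c : Finset W) (A : Set W) : Set (Finset W) :=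
  {t | c ⊂ t ∧ (t : Set W) ⊆ c ∪ A ∧ Γ.IsClique (t : Set W)}

lemma cliquesAbove_finite (c : Finset W) {A : Set W} (hA : A.Finite) :
    (cliquesAbove Γ c A).Finite := by
  have : (↑c ∪ A).Finite := c.finite_toSet.union hA
  refine (finite_setOf_subset this.toFinset).subset fun t ht x hx => ?_
  simpa using ht.2.1 hx

lemma isClique_insert_of_forall_adj [DecidableEq W] {c : Finset W} (hc : Γ.IsClique (c : Set W))
    {x : W} (h : ∀ y ∈ c, Γ.Adj y x) : Γ.IsClique ((insert x c : Finset W) : Set W) := by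
  rw [Finset.coe_insert, SimpleGraph.isClique_insert]
  exact ⟨hc, fun y hy _ => (h y hy).symm⟩

lemma insert_mem_cliquesAbove [DecidableEq W] {c : Finset W} {A : Set W}
    (hc : Γ.IsClique (c : Set W)) (h : ∀ y ∈ c, ∀ a ∈ A, Γ.Adj y a) {x : W} (hx : x ∈ A) :
    insert x c ∈ cliquesAbove Γ c A := by
  refine ⟨Finset.ssubset_insert fun hxc => Γ.irrefl (h x hxc x hx), ?_,
    isClique_insert_of_forall_adj hc fun y hy => h y hy x hx⟩
  rw [Finset.coe_insert]
  exact Set.insert_subset (.inr hx) Set.subset_union_left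

/-- Removing the cliques that contain `x`, apart from the smallest one, preserves contractibility. -/
lemma isContractible_cliquesAbove_diff [DecidableEq W] {c : Finset W} {A : Set W} (hA : A.Finite)
    {x : W} (hxc : x ∉ c) (h : IsContractible (inclusionGraph W) (cliquesAbove Γ c (A \ {x}))) :
    IsContractible (inclusionGraph W) (cliquesAbove Γ c A \ {insert x c}) := by
  have hfin := cliquesAbove_finite (Γ := Γ) c hA
  have hnot : ∀ t ∈ cliquesAbove Γ c (A \ {x}), x ∉ t := fun t ht hxt =>
    (ht.2.1 hxt).elim hxc fun h => h.2 rfl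
  refine h.of_dismantle (hfin.subset Set.sdiff_subset) ?_ (fun t => (t.card : ℤ))
    (fun x _ y _ h e => card_ne_of_adj h (by simpa using e)) ?_
  · intro t ht
    refine ⟨⟨ht.1, ht.2.1.trans (Set.union_subset_union_right _ Set.sdiff_subset), ht.2.2⟩, ?_⟩
    rintro rfl
    exact hnot _ ht (Finset.mem_insert_self x c)
  · rintro t ⟨ht, htx⟩ htA
    have hxt : x ∈ t := by
      by_contra hxt
      refine htA ⟨ht.1, fun y hy => (ht.2.1 hy).imp_right fun hyA => ⟨hyA, ?_⟩, ht.2.2⟩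
      rintro rfl
      exact hxt hy
    -- Cliques containing `x` are removed by increasing size, with apex `t.erase x`. It strictly
    -- contains `c` precisely because `t` is not `insert x c`.
    have hce : c ⊂ t.erase x := by
      refine (Finset.subset_erase.2 ⟨ht.1.1, hxc⟩).ssubset_of_ne fun e => htx ?_
      rw [e, Finset.insert_erase hxt]
      rfl
    have hmem : t.erase x ∈ cliquesAbove Γ c (A \ {x}) := by
      refine ⟨hce, fun y hy => ?_, ht.2.2.subset (Finset.coe_subset.2 (Finset.erase_subset x t))⟩
      have hy' := Finset.mem_erase.1 (Finset.mem_coe.1 hy)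
      exact (ht.2.1 hy'.2).imp_right fun hyA => ⟨hyA, hy'.1⟩
    have hlt : t.erase x ⊂ t := Finset.erase_ssubset hxt
    refine isContractible_of_apex (hfin.subset fun y hy => hy.1.1) (p := t.erase x)
      ⟨⟨⟨hce, fun y hy => ht.2.1 (hlt.1 hy), hmem.2.2⟩, fun e =>
        Finset.notMem_erase x t (Set.mem_singleton_iff.1 e ▸ Finset.mem_insert_self x c)⟩,
        .inr hlt, .inl hmem⟩ ?_
    rintro u ⟨-, htu | htu, hu⟩ hne
    · exact .inl (hlt.trans htu)
    · rcases hu with hu | hu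
      · exact .inr ((Finset.subset_erase.2 ⟨htu.1, hnot u hu⟩).ssubset_of_ne hne)
      · have := Finset.card_lt_card htu
        omega

/-- Passing to a unit sphere moves `x` into the base clique, so the inductions must allow an
arbitrary base `c`. -/
lemma unitSphere_cliquesAbove_insert [DecidableEq W] {c : Finset W} {A : Set W} {x : W}
    (hxc : x ∉ c) (hx : x ∈ A) :
    unitSphere (inclusionGraph W) (cliquesAbove Γ c A) (insert x c) =
      cliquesAbove Γ (insert x c) (unitSphere Γ A x) := by
  ext t
  constructor
  · rintro ⟨ht, hxt | hxt⟩
    · refine ⟨hxt, fun y hy => ?_, ht.2.2⟩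
      by_cases hyx : y = x
      · exact .inl (by simp [hyx])
      · rcases ht.2.1 hy with hyc | hyA
        · exact .inl (Finset.mem_insert_of_mem hyc)
        · exact .inr ⟨hyA, ht.2.2 (hxt.1 (Finset.mem_insert_self x c)) hy (Ne.symm hyx)⟩
    · have h1 := Finset.card_lt_card hxt
      have h2 := Finset.card_lt_card ht.1
      rw [Finset.card_insert_of_notMem hxc] at h1
      omega
  · rintro ⟨hxt, htA, htc⟩
    refine ⟨⟨(Finset.subset_insert x c).trans_ssubset hxt, fun y hy => ?_, htc⟩, .inl hxt⟩
    rcases htA hy with hy | hy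
    · rcases Finset.mem_insert.1 (Finset.mem_coe.1 hy) with rfl | hy
      · exact .inr hx
      · exact .inl hy
    · exact .inr hy.1

/-- The barycentric refinement of a contractible graph is contractible. -/
lemma IsContractible.cliquesAbove {A : Set W} (hA : IsContractible Γ A) {c : Finset W}
    (hc : Γ.IsClique (c : Set W)) (h : ∀ y ∈ c, ∀ a ∈ A, Γ.Adj y a) :
    IsContractible (inclusionGraph W) (cliquesAbove Γ c A) := by
  classical
  induction hA generalizing c with
  | point x =>
    convert IsContractible.point (Γ := inclusionGraph W) (insert x c) using 1
    refine Set.eq_singleton_iff_unique_mem.2 ⟨insert_mem_cliquesAbove hc h rfl, fun t ht => ?_⟩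
    have hsub : t ⊆ insert x c := fun y hy => by
      rcases ht.2.1 hy with hy | hy
      · exact Finset.mem_insert_of_mem hy
      · exact Finset.mem_insert.2 (.inl hy)
    refine Finset.eq_of_subset_of_card_le hsub ?_
    have := Finset.card_lt_card ht.1
    have := Finset.card_insert_le x c
    omega
  | extend A x hx hS hA ihS ihA =>
    have hxc : x ∉ c := fun hxc => Γ.irrefl (h x hxc x hx)
    refine .extend _ (insert x c) (insert_mem_cliquesAbove hc h hx) ?_ ?_
    · rw [unitSphere_cliquesAbove_insert hxc hx]
      refine ihS (isClique_insert_of_forall_adj hc fun y hy => h y hy x hx) fun y hy a ha => ?_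
      rcases Finset.mem_insert.1 hy with rfl | hy
      · exact ha.2
      · exact h y hy a ha.1
    · refine isContractible_cliquesAbove_diff ?_ hxc (ihA hc fun y hy a ha => h y hy a ha.1)
      exact (hA.finite.insert x).subset (by simp)

/-- The first part is the boundary of the simplex `t \ c`, the second the refinement of its link, to
which induction applies. -/
lemma unitSphere_cliquesAbove [DecidableEq W] {c : Finset W} {A : Set W} {t : Finset W}
    (ht : t ∈ cliquesAbove Γ c A) :
    unitSphere (inclusionGraph W) (cliquesAbove Γ c A) t =
      {w | c ⊂ w ∧ w ⊂ t} ∪ cliquesAbove Γ t (commonLink Γ A (t \ c : Finset W)) := by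
  rw [unitSphere_inclusionGraph]
  ext w
  constructor
  · rintro (⟨hw, hwt⟩ | ⟨hw, htw⟩)
    · exact .inl ⟨hw.1, hwt⟩
    · refine .inr ⟨htw, fun y hy => ?_, hw.2.2⟩
      by_cases hyt : y ∈ t
      · exact .inl hyt
      · have hyA : y ∈ A := (hw.2.1 hy).resolve_left fun hyc => hyt (ht.1.1 hyc)
        refine .inr ⟨hyA, fun x hx => ?_⟩
        have hxt : x ∈ t := (Finset.mem_sdiff.1 (Finset.mem_coe.1 hx)).1
        exact hw.2.2 (htw.1 hxt) hy fun e => hyt (e ▸ hxt)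
  · rintro (⟨hcw, hwt⟩ | ⟨htw, hwA, hwc⟩)
    · exact .inl ⟨⟨hcw, fun y hy => ht.2.1 (hwt.1 hy),
        ht.2.2.subset (Finset.coe_subset.2 hwt.1)⟩, hwt⟩
    · refine .inr ⟨⟨ht.1.trans htw, fun y hy => ?_, hwc⟩, htw⟩
      rcases hwA hy with hy | hy
      · exact ht.2.1 hy
      · exact .inr hy.1

lemma sdiff_subset_of_mem_cliquesAbove [DecidableEq W] {c : Finset W} {A : Set W}
    {t : Finset W} (ht : t ∈ cliquesAbove Γ c A) : ((t \ c : Finset W) : Set W) ⊆ A := fun y hy => by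
  have hy' := Finset.mem_sdiff.1 (Finset.mem_coe.1 hy)
  exact (ht.2.1 hy'.1).resolve_left hy'.2

lemma adj_of_mem_commonLink [DecidableEq W] {c : Finset W} {A : Set W}
    (h : ∀ y ∈ c, ∀ a ∈ A, Γ.Adj y a) {t : Finset W} :
    ∀ y ∈ t, ∀ a ∈ commonLink Γ A (t \ c : Finset W), Γ.Adj y a := fun y hy a ha => by
  by_cases hyc : y ∈ c
  · exact h y hyc a ha.1
  · exact ha.2 y (Finset.mem_coe.2 (Finset.mem_sdiff.2 ⟨hy, hyc⟩))

/-- The barycentric refinement of a sphere is a sphere of the same dimension. -/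
lemma IsSphere.cliquesAbove {m : ℤ} {A : Set W} (hA : IsSphere Γ m A) {c : Finset W}
    (hc : Γ.IsClique (c : Set W)) (h : ∀ y ∈ c, ∀ a ∈ A, Γ.Adj y a) :
    IsSphere (inclusionGraph W) m (cliquesAbove Γ c A) := by
  classical
  induction hn : (m + 1).toNat using Nat.strong_induction_on generalizing m A c with
  | _ n ih =>
    have hunit : ∀ t ∈ DiscreteManifold.cliquesAbove Γ c A, IsSphere (inclusionGraph W) (m - 1)
        (DiscreteManifold.unitSphere (inclusionGraph W) (DiscreteManifold.cliquesAbove Γ c A) t) := by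
      intro t ht
      have hcl : IsSphere Γ (m - (t \ c).card) _ := hA.commonLink (t \ c)
        (sdiff_subset_of_mem_cliquesAbove ht)
        (ht.2.2.subset (Finset.coe_subset.2 Finset.sdiff_subset))
      have hcard := Finset.card_sdiff_add_card_eq_card ht.1.1
      have hlt := Finset.card_lt_card ht.1
      -- The link has dimension at least `-1` and below `m`, so `(m + 1).toNat` really drops.
      have hm := hcl.neg_one_le
      have := (isSphere_between ht.1).join
        (ih _ (by omega) hcl ht.2.2 (adj_of_mem_commonLink h) rfl)
        (fun a ha b hb => .inl (ha.2.trans hb.1))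
      rw [unitSphere_cliquesAbove ht]
      convert this using 1
      omega
    cases hA with
    | empty =>
      convert IsSphere.empty (Γ := inclusionGraph W) using 1
      refine Set.eq_empty_of_forall_notMem fun t ht => ht.1.2 fun y hy => ?_
      simpa using ht.2.1 hy
    | step m hm A hS hAc =>
      have hfin := (IsSphere.step m hm A hS hAc).finite
      obtain ⟨x, hx, hxA⟩ := hAc
      refine .step _ hm _ hunit ⟨insert x c, insert_mem_cliquesAbove hc h hx, ?_⟩
      exact isContractible_cliquesAbove_diff hfin (fun hxc => Γ.irrefl (h x hxc x hx))
        (hxA.cliquesAbove hc fun y hy a ha => h y hy a ha.1)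

lemma cliqueComplex_faces (Γ : SimpleGraph W) (A : Set W) :
    (cliqueComplex Γ A).faces = cliquesAbove Γ ∅ A := by
  ext t
  simp [cliqueComplex, cliquesAbove, Finset.empty_ssubset]

/-- The clique complex of a manifold is a manifold of the same dimension. -/
lemma IsManifoldGraph.cliqueComplex {m : ℤ} {A : Set W} (hA : IsManifoldGraph Γ m A) :
    IsManifold m (cliqueComplex Γ A) := by
  classical
  rw [IsManifold, cliqueComplex_faces]
  refine ⟨cliquesAbove_finite _ hA.1, fun t ht => ?_⟩
  have h : ∀ y ∈ (∅ : Finset W), ∀ a ∈ A, Γ.Adj y a := by simp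
  have hcl : IsSphere Γ (m - (t \ ∅).card) _ := hA.commonLink (t \ ∅)
    (by simpa using Finset.empty_ssubset.1 ht.1) (sdiff_subset_of_mem_cliquesAbove ht)
    (by simpa using ht.2.2)
  have := (isSphere_between ht.1).join (hcl.cliquesAbove ht.2.2 (adj_of_mem_commonLink h))
    (fun a ha b hb => .inl (ha.2.trans hb.1))
  rw [unitSphere_cliquesAbove ht]
  convert this using 1
  simp only [Finset.sdiff_empty, Finset.card_empty]
  push_cast
  ring

end Barycentric

/-! ### The level set `U` -/

section Pullback

variable {V : Type*}

/-- The only facet of the complete complex is the full vertex set. -/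
lemma mem_pullbackSet_completeComplex {k : ℕ} {G : AbstractSimplicialComplex V}
    {f : V → Fin (k + 1)} {y : Finset V} :
    y ∈ pullbackSet G f (completeComplex k) ↔ y ∈ G.faces ∧ ∀ b, ∃ v ∈ y, f v = b := by
  have hface : ∀ t : Finset (Fin (k + 1)), t ∈ (completeComplex k).faces ↔ t.Nonempty :=
    fun t => Iff.rfl
  simp only [pullbackSet, hface]
  refine and_congr_right fun _ => ⟨?_, fun h => ⟨Finset.univ, ?_, fun b _ => by simpa using h b⟩⟩
  · rintro ⟨t, ht, hty⟩ b
    have : b ∈ t := ht.2 Finset.univ_nonempty (Finset.subset_univ t) (Finset.mem_univ b)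
    simpa using hty this
  · exact ⟨Finset.univ_nonempty, fun s _ _ => Finset.subset_univ s⟩

/-- The simplices of a `d`-manifold on which `f` takes all `k + 1` values form a
`(d - k)`-manifold. -/
lemma isManifoldGraph_pullbackSet {d : ℤ} {k : ℕ} {G : AbstractSimplicialComplex V}
    (hG : IsManifold d G.toPreAbstractSimplicialComplex) (f : V → Fin (k + 1)) :
    IsManifoldGraph (inclusionGraph V) (d - k) (pullbackSet G f (completeComplex k)) := by
  refine ⟨hG.1.subset fun y hy => hy.1, fun y hy => ?_⟩
  rw [mem_pullbackSet_completeComplex] at hy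
  have := (isSphere_hitting f hy.2).join (hG.isSphere_above hy.1)
    (fun a ha b hb => .inl (ha.1.trans hb.2))
  rw [unitSphere_inclusionGraph]
  convert this using 1
  · rw [Fintype.card_fin]
    push_cast
    ring
  · ext z
    simp only [Set.mem_union, Set.mem_ofPred_eq, mem_pullbackSet_completeComplex]
    constructor
    · rintro (⟨hz, hzy⟩ | ⟨hz, hyz⟩)
      · exact .inl ⟨hzy, hz.2⟩
      · exact .inr ⟨hz.1, hyz⟩
    · rintro (⟨hzy, hz⟩ | ⟨hz, hyz⟩)
      · obtain ⟨v, hv, -⟩ := hz 0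
        exact .inl ⟨⟨(G.isRelLowerSet_faces hy.1).2 hzy.1 ⟨v, hv⟩, hz⟩, hzy⟩
      · exact .inr ⟨⟨hz, fun b => (hy.2 b).imp fun v hv => ⟨hyz.1 hv.1, hv.2⟩⟩, hyz⟩

end Pullback

end DiscreteManifold

open DiscreteManifold in
/-- `G` is a `d`-manifold with vertex set `V` and `f : V → {0,…,k}` is surjective. Then
`H = H(G, f, K_{k+1})` is empty or a `(d-k)`-manifold, both as a graph (the inclusion graph on the
simplices `y` of `G` with `f(y) = {0,…,k}`) and as the complex of complete subgraphs of it. -/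
theorem mainTheorem2 {V : Type*} (d k : ℕ) (G : AbstractSimplicialComplex V)
    (hG : IsManifold (d : ℤ) G.toPreAbstractSimplicialComplex)
    (f : V → Fin (k + 1)) (hf : Function.Surjective f) :
    (IsManifoldGraph (inclusionGraph V) ((d : ℤ) - (k : ℤ))
        (pullbackSet G f (completeComplex k)) ∧
      IsManifold ((d : ℤ) - (k : ℤ)) (pullback G f (completeComplex k))) ∨
    (pullback G f (completeComplex k)).faces = ∅ := by
  -- The first alternative covers empty `U` too, where the sphere conditions are vacuous.
  exact .inl ⟨isManifoldGraph_pullbackSet hG f, (isManifoldGraph_pullbackSet hG f).cliqueComplex⟩
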